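/- Let $X$ be a Tychonoff space, let $C(X)$ be the ring of real-valued continuous functions on $X$ and $C^*(X)$ its subring of bounded functions, and let $A$ be an intermediate ring, i.e. a subalgebra with $C^*(X)\subseteq A\subseteq C(X)$. For an intermediate ring $B$ and $f\in B$ let $\mathcal Z_B(f)$ be the family of all zero-sets $E$ of $X$ for which there is $g\in B$ with $fg=1$ on $X\setminus E$. For $p\in\beta X$ let $$M_B^p=\{f\in B:\ p\in \operatorname{cl}_{\beta X}E\ \text{ for all } E\in\mathcal Z_B(f)\},$$ a maximal ideal of $B$, and order the residue class field $B/M_B^p$ by the quotient of the pointwise order of $B$ (so $a\le b$ if and only if $a,b$ have representatives $f\le g$); this makes it a totally ordered field. Put $\upsilon_B X=\{p\in\beta X:\ B/M_B^p\cong\mathbb R\}$. For $f\in C(X)$ let $f^*:\beta X\to\mathbb R\cup\{\infty\}$ be its Stone extension into the one-point compactification of $\mathbb R$, and let $A^\nu=\{f\in C(X):\ f^*(\upsilon_A X)\subseteq\mathbb R\}$, which is again an intermediate ring. Then for every $p\in\beta X\setminus\upsilon_{A^\nu}X$ the ordered field $K=A^\nu/M_{A^\nu}^p$ is real closed; it is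 an $\eta_1$-set, i.e. for any two countable (possibly empty) subsets $S,T\subseteq K$ with $s<t$ for all $s\in S$, $t\in T$ there is $x\in K$ with $s<x<t$ for all $s\in S$, $t\in T$; and its transcendence degree over $\mathbb R$ (where $\mathbb R\subseteq K$ as the classes of constant functions), and hence also over $\mathbb Q$, is at least $\mathfrak c=2^{\aleph_0}$. -/

import Mathlib

open Set Filter Topology

universe u

/-- An intermediate ring of continuous functions on `X`: a subalgebra `A` of `C(X)` with
`C*(X) ⊆ A ⊆ C(X)`. -/
structure IntermediateRing (X : Type u) [TopologicalSpace X] where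
  /-- The underlying subalgebra of `C(X)`. -/
  alg : Subalgebra ℝ C(X, ℝ)
  /-- Every bounded continuous function belongs to the ring. -/
  mem_of_bounded : ∀ f : C(X, ℝ), (∃ C : ℝ, ∀ x, |f x| ≤ C) → f ∈ alg

namespace IntermediateRing

variable {X : Type u} [TopologicalSpace X]

/-- The Stone extension `f* : βX → ℝ ∪ {∞}` of a continuous real function on `X`. -/
noncomputable def stoneExt (f : C(X, ℝ)) : StoneCech X → OnePoint ℝ :=
  stoneCechExtend (g := fun x => ((f x : ℝ) : OnePoint ℝ))
    (OnePoint.continuous_coe.comp f.continuous)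

/-- The family `Z_A(f)` of all zero-sets `E` of `X` such that `f` is invertible in `A` off `E`,
that is, `f g = 1` on `X \ E` for some `g ∈ A`. -/
def zeroSets (A : IntermediateRing X) (f : C(X, ℝ)) : Set (Set X) :=
  {E | (∃ e : C(X, ℝ), E = {x | e x = 0}) ∧ ∃ g ∈ A.alg, ∀ x ∉ E, f x * g x = 1}

/-! ### Facts used to see that the sets `M_A^p` below are maximal ideals -/

/-- The trace on `X` of the neighbourhood filter of a point of `βX`. -/
def trace (p : StoneCech X) : Filter X := comap stoneCechUnit (𝓝 p)

instance trace_neBot (p : StoneCech X) : (trace p).NeBot :=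
  comap_neBot_iff.2 fun t ht => by
    obtain ⟨_, hy, x, rfl⟩ :=
      (mem_closure_iff_nhds.1 ((denseRange_stoneCechUnit (α := X)) p)) t ht
    exact ⟨x, hy⟩

theorem mem_closure_iff_trace (p : StoneCech X) (E : Set X) :
    p ∈ closure (stoneCechUnit '' E) ↔ ∃ᶠ x in trace p, x ∈ E := by
  rw [mem_closure_iff_frequently, trace, frequently_comap]
  simp only [mem_image, and_comm]

theorem tendsto_stoneExt (f : C(X, ℝ)) (p : StoneCech X) :
    Tendsto (fun x => ((f x : ℝ) : OnePoint ℝ)) (trace p) (𝓝 (stoneExt f p)) := by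
  have h : Continuous (stoneExt f) := continuous_stoneCechExtend _
  have h2 := (h.tendsto p).comp (tendsto_comap (f := (stoneCechUnit : X → StoneCech X)))
  refine h2.congr fun x => ?_
  simp [stoneExt]

theorem stoneExt_eq_coe_iff (f : C(X, ℝ)) (p : StoneCech X) (r : ℝ) :
    stoneExt f p = (r : OnePoint ℝ) ↔ Tendsto f (trace p) (𝓝 r) := by
  constructor
  · intro h
    have h2 := tendsto_stoneExt f p
    rw [h] at h2
    exact (OnePoint.isOpenEmbedding_coe.isEmbedding.tendsto_nhds_iff).2 h2
  · intro h
    exact tendsto_nhds_unique (tendsto_stoneExt f p)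
      ((OnePoint.continuous_coe.tendsto r).comp h)

theorem exists_eventually_lt (f : C(X, ℝ)) (p : StoneCech X)
    (h : ¬ Tendsto f (trace p) (𝓝 0)) : ∃ ε > 0, ∀ᶠ x in trace p, ε < |f x| := by
  rw [← stoneExt_eq_coe_iff] at h
  have h2 := tendsto_stoneExt f p
  have hU : IsOpen ({(0 : ℝ)}ᶜ : Set ℝ) := isOpen_compl_singleton
  induction hp : stoneExt f p using OnePoint.rec with
  | infty =>
    rw [hp] at h2
    have h3 : Tendsto f (trace p) (cocompact ℝ) := by
      rw [← coclosedCompact_eq_cocompact, ← OnePoint.comap_coe_nhds_infty, tendsto_comap_iff]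
      exact h2
    exact ⟨1, one_pos, (tendsto_norm_cocompact_atTop.comp h3).eventually_gt_atTop 1⟩
  | coe r =>
    have hr : r ≠ 0 := fun h0 => h (by rw [hp, h0])
    have h3 := ((stoneExt_eq_coe_iff f p r).1 hp).abs
    exact ⟨|r| / 2, by positivity, h3.eventually_const_lt (half_lt_self (abs_pos.2 hr))⟩

/-- A bounded function that is inverse to `u` wherever `ε ≤ |u|`. -/
theorem exists_bounded_inverse (A : IntermediateRing X) (u : C(X, ℝ)) {ε : ℝ} (hε : 0 < ε) :
    ∃ k ∈ A.alg, ∀ x, ε ≤ |u x| → u x * k x = 1 := by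
  have hpos : ∀ x, 0 < max (u x ^ 2) (ε ^ 2) := fun x => lt_max_of_lt_right (by positivity)
  refine ⟨⟨fun x => u x / max (u x ^ 2) (ε ^ 2), ?_⟩, A.mem_of_bounded _ ⟨1 / ε, fun x => ?_⟩,
    fun x hx => ?_⟩
  · exact u.continuous.div (by fun_prop) fun x => (hpos x).ne'
  · simp only [ContinuousMap.coe_mk]
    rw [abs_div, abs_of_pos (hpos x), div_le_div_iff₀ (hpos x) hε, one_mul]
    rcases le_total (|u x|) ε with h | h
    · exact le_max_of_le_right (by nlinarith [abs_nonneg (u x)])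
    · exact le_max_of_le_left (by rw [← sq_abs]; nlinarith [abs_nonneg (u x)])
  · have h1 : ε ^ 2 ≤ u x ^ 2 := by rw [← sq_abs (u x)]; gcongr
    have h2 : u x ^ 2 ≠ 0 := (lt_of_lt_of_le (by positivity) h1).ne'
    simp only [ContinuousMap.coe_mk]
    rw [max_eq_left h1, mul_div_assoc', ← sq, div_self h2]

theorem zeroSets_cluster_iff (A : IntermediateRing X) (p : StoneCech X) (f : C(X, ℝ)) :
    (∀ E ∈ A.zeroSets f, p ∈ closure (stoneCechUnit '' E)) ↔
      ∀ g ∈ A.alg, Tendsto (fun x => f x * g x) (trace p) (𝓝 0) := by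
  constructor
  · intro h g hg
    by_contra hlim
    obtain ⟨ε, hε, hev⟩ := exists_eventually_lt (f * g) p hlim
    obtain ⟨k, hk, hk1⟩ := A.exists_bounded_inverse (f * g) hε
    have hE : {x | |f x * g x| ≤ ε} ∈ A.zeroSets f := by
      refine ⟨⟨⟨fun x => max (|f x * g x| - ε) 0, by fun_prop⟩, ?_⟩, g * k,
        A.alg.mul_mem hg hk, fun x hx => ?_⟩
      · ext x
        simp
      · rw [ContinuousMap.mul_apply, ← mul_assoc]
        exact hk1 x (not_le.1 hx).le
    obtain ⟨x, hx1, hx2⟩ := (((mem_closure_iff_trace p _).1 (h _ hE)).and_eventually hev).exists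
    exact absurd hx2 (not_lt.2 hx1)
  · rintro h E ⟨-, g, hg, hE⟩
    rw [mem_closure_iff_trace]
    intro hev
    have h1 : Tendsto (fun x => f x * g x) (trace p) (𝓝 1) :=
      tendsto_const_nhds.congr' (hev.mono fun x hx => (hE x hx).symm)
    exact zero_ne_one (tendsto_nhds_unique (h g hg) h1)

theorem mem_of_le (A : IntermediateRing X) {f g : C(X, ℝ)} (hf : f ∈ A.alg)
    (hg : ∀ x, |g x| ≤ |f x|) : g ∈ A.alg := by
  have hpos : ∀ x, 0 < 1 + f x ^ 2 := fun x => by positivity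
  have hk : (⟨fun x => g x / (1 + f x ^ 2),
      g.continuous.div (by fun_prop) fun x => (hpos x).ne'⟩ : C(X, ℝ)) ∈ A.alg := by
    refine A.mem_of_bounded _ ⟨1, fun x => ?_⟩
    simp only [ContinuousMap.coe_mk]
    rw [abs_div, abs_of_pos (hpos x), div_le_one (hpos x)]
    have := hg x
    rw [← sq_abs (f x)]
    nlinarith [sq_nonneg (|f x| - 1)]
  have h2 := A.alg.mul_mem (A.alg.add_mem A.alg.one_mem (A.alg.pow_mem hf 2)) hk
  convert h2 using 1
  ext x
  simp [mul_div_cancel₀ _ (hpos x).ne']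

/-! ### Maximal ideals and residue fields -/

/-- The maximal ideal `M_A^p` of `A` attached to the point `p` of `βX`: all `f ∈ A` such that
`p` is a cluster point of `Z_A(f)`, i.e. `p` lies in the closure in `βX` of every `E ∈ Z_A(f)`. -/
def maxIdeal (A : IntermediateRing X) (p : StoneCech X) : Ideal A.alg where
  carrier := {f | ∀ E ∈ A.zeroSets (f : C(X, ℝ)), p ∈ closure (stoneCechUnit '' E)}
  zero_mem' := by
    simp only [mem_ofPred_eq, zeroSets_cluster_iff]
    intro g _
    simp
  add_mem' := by
    intro a b ha hb
    simp only [mem_ofPred_eq, zeroSets_cluster_iff] at ha hb ⊢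
    intro g hg
    simpa [add_mul] using (ha g hg).add (hb g hg)
  smul_mem' := by
    intro c a ha
    simp only [mem_ofPred_eq, zeroSets_cluster_iff] at ha ⊢
    intro g hg
    refine (ha (c * g) (A.alg.mul_mem c.2 hg)).congr fun x => ?_
    simp [mul_comm, mul_left_comm]

theorem mem_maxIdeal_iff (A : IntermediateRing X) (p : StoneCech X) (f : A.alg) :
    f ∈ A.maxIdeal p ↔
      ∀ g ∈ A.alg, Tendsto (fun x => f.1 x * g x) (trace p) (𝓝 0) :=
  A.zeroSets_cluster_iff p f

instance maxIdeal_isMaximal (A : IntermediateRing X) (p : StoneCech X) :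
    (A.maxIdeal p).IsMaximal := by
  rw [Ideal.isMaximal_iff]
  refine ⟨fun h => ?_, fun J f hJ hf hfJ => ?_⟩
  · have h1 := (A.mem_maxIdeal_iff p 1).1 h 1 A.alg.one_mem
    have h2 : Tendsto (fun _ : X => (1 : ℝ)) (trace p) (𝓝 0) :=
      h1.congr fun x => one_mul 1
    exact zero_ne_one (tendsto_nhds_unique h2 tendsto_const_nhds)
  · rw [mem_maxIdeal_iff] at hf
    push Not at hf
    obtain ⟨g, hg, hlim⟩ := hf
    obtain ⟨ε, hε, hev⟩ := exists_eventually_lt (f.1 * g) p hlim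
    obtain ⟨k, hk, hk1⟩ := A.exists_bounded_inverse (f.1 * g) hε
    have hM : (1 : A.alg) - ⟨g, hg⟩ * ⟨k, hk⟩ * f ∈ A.maxIdeal p := by
      rw [mem_maxIdeal_iff]
      intro h _
      refine tendsto_const_nhds.congr' (hev.mono fun x hx => ?_)
      have := hk1 x hx.le
      rw [ContinuousMap.mul_apply] at this
      have h3 : g x * k x * f.1 x = 1 := by rw [← this]; ring
      simp [h3]
    have := J.add_mem (hJ hM) (J.mul_mem_left (⟨g, hg⟩ * ⟨k, hk⟩) hfJ)
    simpa using this

/-- The residue class field `A/M_A^p`. -/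
def ResidueField (A : IntermediateRing X) (p : StoneCech X) : Type u :=
  A.alg ⧸ A.maxIdeal p

noncomputable instance (A : IntermediateRing X) (p : StoneCech X) : Field (A.ResidueField p) :=
  Ideal.Quotient.field (A.maxIdeal p)

/-- The canonical homomorphism `A → A/M_A^p`. -/
def residue (A : IntermediateRing X) (p : StoneCech X) : A.alg →+* A.ResidueField p :=
  Ideal.Quotient.mk (A.maxIdeal p)

theorem residue_surjective (A : IntermediateRing X) (p : StoneCech X) :
    Function.Surjective (A.residue p) :=
  Ideal.Quotient.mk_surjective

theorem residue_eq_zero_iff (A : IntermediateRing X) (p : StoneCech X) (f : A.alg) :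
    A.residue p f = 0 ↔ f ∈ A.maxIdeal p :=
  Ideal.Quotient.eq_zero_iff_mem

/-- The field `A/M_A^p` contains `ℝ` as the residue classes of the constant functions. -/
noncomputable instance (A : IntermediateRing X) (p : StoneCech X) :
    Algebra ℝ (A.ResidueField p) :=
  ((A.residue p).comp (algebraMap ℝ A.alg)).toAlgebra

theorem mem_maxIdeal_of_le (A : IntermediateRing X) (p : StoneCech X) {f g : A.alg}
    (hf : f ∈ A.maxIdeal p) (hg : ∀ x, |g.1 x| ≤ |f.1 x|) : g ∈ A.maxIdeal p := by
  rw [mem_maxIdeal_iff] at hf ⊢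
  intro h hh
  have h1 := (hf h hh).abs
  rw [abs_zero] at h1
  refine squeeze_zero_norm (fun x => ?_) h1
  rw [Real.norm_eq_abs, abs_mul, abs_mul]
  exact mul_le_mul_of_nonneg_right (hg x) (abs_nonneg _)

/-- The order of `A/M_A^p` is the quotient of the pointwise order of `A`: `a ≤ b` if and only if
`a` and `b` have representatives `f`, `g` with `f ≤ g` pointwise. -/
instance (A : IntermediateRing X) (p : StoneCech X) : LE (A.ResidueField p) where
  le a b := ∃ f g : A.alg, A.residue p f = a ∧
    A.residue p g = b ∧ ∀ x, f.1 x ≤ g.1 x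

theorem residue_le_iff (A : IntermediateRing X) (p : StoneCech X) (a b : A.ResidueField p) :
    a ≤ b ↔ ∃ h : A.alg, A.residue p h = b - a ∧ ∀ x, 0 ≤ h.1 x := by
  constructor
  · rintro ⟨f, g, rfl, rfl, h⟩
    exact ⟨g - f, map_sub _ _ _, fun x => by simpa using h x⟩
  · rintro ⟨h, hh, h0⟩
    obtain ⟨f, rfl⟩ := A.residue_surjective p a
    exact ⟨f, f + h, rfl, by rw [map_add, hh]; ring, fun x => by simpa using h0 x⟩

noncomputable instance (A : IntermediateRing X) (p : StoneCech X) :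
    LinearOrder (A.ResidueField p) where
  le_refl a := (A.residue_le_iff p a a).2 ⟨0, by simp, fun x => le_rfl⟩
  le_trans a b c hab hbc := by
    rw [residue_le_iff] at *
    obtain ⟨f, hf, hf0⟩ := hab
    obtain ⟨g, hg, hg0⟩ := hbc
    exact ⟨f + g, by rw [map_add, hf, hg]; ring, fun x => add_nonneg (hf0 x) (hg0 x)⟩
  le_antisymm a b hab hba := by
    rw [residue_le_iff] at *
    obtain ⟨f, hf, hf0⟩ := hab
    obtain ⟨g, hg, hg0⟩ := hba
    have h1 : f + g ∈ A.maxIdeal p := by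
      rw [← residue_eq_zero_iff, map_add, hf, hg]; ring
    have h2 : f ∈ A.maxIdeal p := A.mem_maxIdeal_of_le p h1 fun x => by
      have h3 : (f + g).1 x = f.1 x + g.1 x := rfl
      rw [h3, abs_of_nonneg (hf0 x), abs_of_nonneg (add_nonneg (hf0 x) (hg0 x))]
      exact le_add_of_nonneg_right (hg0 x)
    rw [(A.residue_eq_zero_iff p _).2 h2] at hf
    exact (sub_eq_zero.1 hf.symm).symm
  le_total a b := by
    rw [residue_le_iff, residue_le_iff]
    obtain ⟨h, hh⟩ := A.residue_surjective p (b - a)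
    have hp : (⟨fun x => max (h.1 x) 0, by fun_prop⟩ : C(X, ℝ)) ∈ A.alg :=
      A.mem_of_le h.2 fun x => by
        simp only [ContinuousMap.coe_mk]
        rw [abs_of_nonneg (le_max_right _ _)]
        exact max_le (le_abs_self _) (abs_nonneg _)
    have hn : (⟨fun x => max (-h.1 x) 0, by fun_prop⟩ : C(X, ℝ)) ∈ A.alg :=
      A.mem_of_le h.2 fun x => by
        simp only [ContinuousMap.coe_mk]
        rw [abs_of_nonneg (le_max_right _ _)]
        exact max_le (neg_le_abs _) (abs_nonneg _)
    have hsub : h = ⟨_, hp⟩ - ⟨_, hn⟩ := by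
      ext x
      change h.1 x = max (h.1 x) 0 - max (-h.1 x) 0
      rcases le_total (h.1 x) 0 with h0 | h0
      · rw [max_eq_right h0, max_eq_left (neg_nonneg.2 h0)]; ring
      · rw [max_eq_left h0, max_eq_right (neg_nonpos.2 h0)]; ring
    have hmul : (⟨_, hp⟩ * ⟨_, hn⟩ : A.alg) = 0 := by
      ext x
      change max (h.1 x) 0 * max (-h.1 x) 0 = 0
      rcases le_total (h.1 x) 0 with h0 | h0
      · rw [max_eq_right h0, zero_mul]
      · rw [max_eq_right (neg_nonpos.2 h0), mul_zero]
    have hprime : (A.maxIdeal p).IsPrime := (A.maxIdeal_isMaximal p).isPrime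
    have hz : (⟨_, hp⟩ * ⟨_, hn⟩ : A.alg) ∈ A.maxIdeal p := by
      rw [hmul]; exact zero_mem _
    rw [hsub, map_sub] at hh
    rcases hprime.mem_or_mem hz with h1 | h1
    · right
      rw [(A.residue_eq_zero_iff p _).2 h1] at hh
      exact ⟨⟨_, hn⟩, by rw [← neg_sub b a, ← hh]; ring, fun x => le_max_right _ _⟩
    · left
      rw [(A.residue_eq_zero_iff p _).2 h1] at hh
      exact ⟨⟨_, hp⟩, by rw [← hh]; ring, fun x => le_max_right _ _⟩
  toDecidableLE := Classical.decRel _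

instance (A : IntermediateRing X) (p : StoneCech X) : IsStrictOrderedRing (A.ResidueField p) :=
  have : IsOrderedAddMonoid (A.ResidueField p) :=
    { add_le_add_left := fun a b hab c => by
        rw [residue_le_iff] at *
        simpa using hab }
  have : ZeroLEOneClass (A.ResidueField p) :=
    ⟨(A.residue_le_iff p 0 1).2 ⟨1, by rw [map_one, sub_zero], fun x => zero_le_one⟩⟩
  have : IsOrderedRing (A.ResidueField p) := .of_mul_nonneg fun a b ha hb => by
    rw [residue_le_iff, sub_zero] at *
    obtain ⟨f, rfl, hf0⟩ := ha
    obtain ⟨g, rfl, hg0⟩ := hb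
    exact ⟨f * g, map_mul _ _ _, fun x => mul_nonneg (hf0 x) (hg0 x)⟩
  IsOrderedRing.toIsStrictOrderedRing _

/-! ### The space `υ_A X` and the ring `A^ν` -/

/-- `υ_A X`, the set of all `p ∈ βX` such that the residue class field `A/M_A^p` is isomorphic
to `ℝ`. -/
def realPoints (A : IntermediateRing X) : Set (StoneCech X) :=
  {p | Nonempty (A.ResidueField p ≃+* ℝ)}

/-- The intermediate ring `A^ν` of all `f ∈ C(X)` whose Stone extension `f*` takes only real
values on `υ_A X`. -/
noncomputable def nu (A : IntermediateRing X) : IntermediateRing X where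
  alg :=
    { carrier := {f | ∀ p ∈ A.realPoints, ∃ r : ℝ, stoneExt f p = (r : OnePoint ℝ)}
      mul_mem' := by
        intro f g hf hg p hp
        obtain ⟨r, hr⟩ := hf p hp
        obtain ⟨s, hs⟩ := hg p hp
        rw [stoneExt_eq_coe_iff] at hr hs
        exact ⟨r * s, (stoneExt_eq_coe_iff _ _ _).2 (hr.mul hs)⟩
      add_mem' := by
        intro f g hf hg p hp
        obtain ⟨r, hr⟩ := hf p hp
        obtain ⟨s, hs⟩ := hg p hp
        rw [stoneExt_eq_coe_iff] at hr hs
        exact ⟨r + s, (stoneExt_eq_coe_iff _ _ _).2 (hr.add hs)⟩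
      algebraMap_mem' := fun r p _ =>
        ⟨r, (stoneExt_eq_coe_iff _ _ _).2 tendsto_const_nhds⟩ }
  mem_of_bounded := by
    rintro f ⟨C, hC⟩ p -
    induction hp : stoneExt f p using OnePoint.rec with
    | coe r => exact ⟨r, rfl⟩
    | infty =>
      exfalso
      have h2 := tendsto_stoneExt f p
      rw [hp] at h2
      have h3 : Tendsto f (trace p) (cocompact ℝ) := by
        rw [← coclosedCompact_eq_cocompact, ← OnePoint.comap_coe_nhds_infty, tendsto_comap_iff]
        exact h2
      obtain ⟨x, hx⟩ :=
        ((tendsto_norm_cocompact_atTop.comp h3).eventually_gt_atTop C).exists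
      exact absurd hx (not_lt.2 (hC x))

end IntermediateRing

/-- A totally ordered set is an `η₁`-set if any two countable (possibly empty) subsets `S`, `T`
with `S < T` elementwise can be separated strictly by an element. -/
def IsEtaOne (K : Type*) [LinearOrder K] : Prop :=
  ∀ S T : Set K, S.Countable → T.Countable → (∀ s ∈ S, ∀ t ∈ T, s < t) →
    ∃ x : K, (∀ s ∈ S, s < x) ∧ ∀ t ∈ T, x < t

/-! Put `Y = υ_A X ∪ X` inside `βX`. A function of `A^ν` has a Stone extension that is real on `Y`,
so `A^ν` consists of the restrictions to `X` of the functions in `C(Y)`. Hence `K` is the image of a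
full ring `C(Y)` under a surjective `ρ`, and the classical theory of residue fields of `C(Y)`
applies. Equality and order in `K` are equality and order along the filter generated by the
zero-sets of functions in `ker ρ` (`map_eq_iff_eventually`, `map_lt_iff_eventually`).

Real closedness: nonnegative elements have square roots, taken pointwise. A monic polynomial of odd
degree over `K` lifts to `C(Y)`; its real roots at the points of `Y` are covered by finitely many
continuous functions `r` (`exists_list_continuous_roots`). The product of the values of the lift at
these `r` vanishes everywhere, so some `ρ r` is a root because `K` has no zero divisors.

If `K` is not `ℝ`, it has an infinitely large element `ρ h`, and `h → ∞` along the filter. Locally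
finite series that switch on their `n`-th term as `h` passes `n` then bound or interpolate countably
many functions (`exists_rampSum`), which gives the `η₁` property. Real powers of `max h 1`, with
exponents in a basis of `ℝ` over `ℚ`, are algebraically independent because distinct monomials grow
at distinct rates. -/

/-! ### Continuous dependence of real polynomial roots on the coefficients -/

section ContinuousRoots

variable {Y : Type*} [TopologicalSpace Y]

open Polynomial

/-- Two minimisers of `|g|` with values of opposite sign enclose a zero of `g`, so the minimum is
zero. Uniqueness makes the minimiser a canonical substitute for the zero where none exists. -/
theorem eq_of_isMinOn_abs_of_injOn {g : ℝ → ℝ} {a b s t : ℝ} (hg : Continuous g)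
    (hinj : InjOn g (Icc a b)) (hs : s ∈ Icc a b) (ht : t ∈ Icc a b)
    (hsm : ∀ w ∈ Icc a b, |g s| ≤ |g w|) (htm : ∀ w ∈ Icc a b, |g t| ≤ |g w|) : s = t := by
  apply hinj hs ht
  have habs : |g s| = |g t| := le_antisymm (hsm t ht) (htm s hs)
  rcases abs_eq_abs.1 habs with h | h
  · exact h
  · have h0 : (0 : ℝ) ∈ g '' uIcc s t := by
      apply intermediate_value_uIcc hg.continuousOn
      rw [mem_uIcc, h]
      rcases le_total (g t) 0 with h | h
      · right; constructor <;> linarith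
      · left; constructor <;> linarith
    obtain ⟨w, hw, hw0⟩ := h0
    have hw' : w ∈ Icc a b := (Set.uIcc_subset_Icc hs ht) hw
    have h1 := hsm w hw'
    have h2 := htm w hw'
    rw [hw0, abs_zero] at h1 h2
    rw [abs_nonpos_iff.1 h1, abs_nonpos_iff.1 h2]

/-- If `G y` is injective on `[c y, d y]` for every `y`, then the zero of `G y` in that interval,
wherever there is one, is given by a continuous function of `y`. -/
theorem exists_continuous_zero {G : Y → ℝ → ℝ} (hG : Continuous fun z : Y × ℝ => G z.1 z.2)
    {c d : C(Y, ℝ)} (hcd : c ≤ d) (hinj : ∀ y, InjOn (G y) (Icc (c y) (d y))) :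
    ∃ r : C(Y, ℝ), ∀ y, ∀ t ∈ Icc (c y) (d y), G y t = 0 → r y = t := by
  have hGy : ∀ y, Continuous (G y) := fun y => hG.comp (Continuous.prodMk_right y)
  -- The minimiser of `|G y|` is defined for every `y` and is the zero whenever there is one.
  have hmin : ∀ y, ∃ s ∈ Icc (c y) (d y), ∀ w ∈ Icc (c y) (d y), |G y s| ≤ |G y w| := fun y =>
    isCompact_Icc.exists_isMinOn (nonempty_Icc.2 (hcd y)) (hGy y).abs.continuousOn
  choose r hr hrm using hmin
  have huniq : ∀ y, ∀ t ∈ Icc (c y) (d y), (∀ w ∈ Icc (c y) (d y), |G y t| ≤ |G y w|) → r y = t :=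
    fun y t ht htm => eq_of_isMinOn_abs_of_injOn (hGy y) (hinj y) (hr y) ht (hrm y) htm
  have hcont : Continuous r := by
    rw [continuous_iff_continuousAt]
    intro y
    rw [ContinuousAt, tendsto_iff_ultrafilter]
    intro U hU
    have hU' : Tendsto id (U : Filter Y) (𝓝 y) := hU
    have hc : Tendsto c U (𝓝 (c y)) := (c.continuous.tendsto y).comp hU'
    have hd : Tendsto d U (𝓝 (d y)) := (d.continuous.tendsto y).comp hU'
    have hbdd : ∀ᶠ z in (U : Filter Y), r z ∈ Icc (c y - 1) (d y + 1) := by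
      filter_upwards [hc.eventually_const_lt (sub_one_lt (c y)),
        hd.eventually_lt_const (lt_add_one (d y))] with z h1 h2
      exact ⟨h1.le.trans (hr z).1, (hr z).2.trans h2.le⟩
    -- By compactness `r` converges along the ultrafilter; the limit is again a minimiser of `|G
    -- y|`, hence equals `r y`.
    obtain ⟨t, -, ht⟩ := (isCompact_Icc (a := c y - 1) (b := d y + 1)).ultrafilter_le_nhds
      (U.map r) (le_principal_iff.2 hbdd)
    have ht' : Tendsto r U (𝓝 t) := ht
    have htc : c y ≤ t := le_of_tendsto_of_tendsto' hc ht' fun z => (hr z).1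
    have htd : t ≤ d y := le_of_tendsto_of_tendsto' ht' hd fun z => (hr z).2
    have hlim : ∀ {v : Y → ℝ} {s : ℝ}, Tendsto v U (𝓝 s) →
        Tendsto (fun z => |G z (v z)|) U (𝓝 |G y s|) := fun {v s} hv =>
      ((hG.tendsto (y, s)).comp (hU'.prodMk_nhds hv)).abs
    have := huniq y t ⟨htc, htd⟩ fun w hw => by
      -- The competitor `w` need not lie in the interval over `z`, so it is clamped to `[c z, d z]`;
      -- the clamped points tend to `w`.
      have hv : Tendsto (fun z => max (c z) (min w (d z))) U (𝓝 (max (c y) (min w (d y)))) :=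
        hc.max (tendsto_const_nhds.min hd)
      rw [min_eq_left hw.2, max_eq_right hw.1] at hv
      exact le_of_tendsto_of_tendsto' (hlim ht') (hlim hv) fun z =>
        hrm z _ ⟨le_max_left _ _, max_le (hcd z) (min_le_right _ _)⟩
    rw [this]
    exact ht'
  refine ⟨⟨r, hcont⟩, fun y t ht h0 => huniq y t ht fun w _ => ?_⟩
  rw [h0, abs_zero]
  exact abs_nonneg _

/-- Insertion sort by lattice operations: `f ⊓ g` becomes the head and `f ⊔ g` is inserted further
on. The clause on lower bounds is what keeps the new head below the new tail in the induction. -/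
theorem exists_sorted_insert (l : List C(Y, ℝ)) (hl : l.Pairwise (· ≤ ·)) (f : C(Y, ℝ)) :
    ∃ l' : List C(Y, ℝ), l'.Pairwise (· ≤ ·) ∧
      (∀ r ∈ f :: l, ∀ y, ∃ r' ∈ l', r' y = r y) ∧
      ∀ g, g ≤ f → (∀ h ∈ l, g ≤ h) → ∀ h ∈ l', g ≤ h := by
  induction l generalizing f with
  | nil =>
    refine ⟨[f], by simp, fun r hr y => ⟨r, hr, rfl⟩, fun g hg _ h hh => ?_⟩
    rwa [List.mem_singleton.1 hh]
  | cons g l ih =>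
    rw [List.pairwise_cons] at hl
    obtain ⟨l', hs, hc, hb⟩ := ih hl.2 (f ⊔ g)
    refine ⟨(f ⊓ g) :: l', ?_, fun r hr y => ?_, fun k hkf hk h hh => ?_⟩
    · rw [List.pairwise_cons]
      exact ⟨hb _ (inf_le_left.trans le_sup_left) fun h hh => inf_le_right.trans (hl.1 h hh), hs⟩
    · obtain ⟨m, hm, hmy⟩ := hc (f ⊔ g) List.mem_cons_self y
      rw [ContinuousMap.sup_apply] at hmy
      rw [List.mem_cons, List.mem_cons] at hr
      rcases le_total (f y) (g y) with h | h
      · rw [max_eq_right h] at hmy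
        rcases hr with rfl | rfl | hr
        · exact ⟨_, List.mem_cons_self, by simp [h]⟩
        · exact ⟨m, List.mem_cons_of_mem _ hm, hmy⟩
        · obtain ⟨r', h1, h2⟩ := hc r (List.mem_cons_of_mem _ hr) y
          exact ⟨r', List.mem_cons_of_mem _ h1, h2⟩
      · rw [max_eq_left h] at hmy
        rcases hr with rfl | rfl | hr
        · exact ⟨m, List.mem_cons_of_mem _ hm, hmy⟩
        · exact ⟨_, List.mem_cons_self, by simp [h]⟩
        · obtain ⟨r', h1, h2⟩ := hc r (List.mem_cons_of_mem _ hr) y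
          exact ⟨r', List.mem_cons_of_mem _ h1, h2⟩
    · rcases List.mem_cons.1 hh with rfl | hh
      · exact le_inf hkf (hk g List.mem_cons_self)
      · exact hb k (hkf.trans le_sup_left) (fun h hh => hk h (List.mem_cons_of_mem _ hh)) h hh

/-- Finitely many continuous functions can be rearranged pointwise into increasing order, the
resulting functions being continuous. -/
theorem exists_sorted (l : List C(Y, ℝ)) :
    ∃ l' : List C(Y, ℝ), l'.Pairwise (· ≤ ·) ∧ ∀ r ∈ l, ∀ y, ∃ r' ∈ l', r' y = r y := by
  induction l with
  | nil => exact ⟨[], by simp, by simp⟩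
  | cons f l ih =>
    obtain ⟨l', hs, hc⟩ := ih
    obtain ⟨l'', hs', hc', -⟩ := exists_sorted_insert l' hs f
    refine ⟨l'', hs', fun r hr y => ?_⟩
    rcases List.mem_cons.1 hr with rfl | hr
    · exact hc' r List.mem_cons_self y
    · obtain ⟨r', h1, h2⟩ := hc r hr y
      obtain ⟨r'', h3, h4⟩ := hc' r' (List.mem_cons_of_mem _ h1) y
      exact ⟨r'', h3, h4.trans h2⟩

/-- If `G y` is injective on intervals free of points of `crit y`, and `crit y` is enumerated by
a sorted list of continuous functions, then so are the zeros of `G y` in the range of the list. -/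
theorem exists_list_zeros {G : Y → ℝ → ℝ} (hG : Continuous fun z : Y × ℝ => G z.1 z.2)
    {crit : Y → Set ℝ}
    (hinj : ∀ y u v, (∀ w ∈ Ioo u v, w ∉ crit y) → InjOn (G y) (Icc u v))
    (l : List C(Y, ℝ)) (a : C(Y, ℝ)) (hl : (a :: l).Pairwise (· ≤ ·))
    (hcrit : ∀ y, ∀ w ∈ crit y, w ≤ a y ∨ ∃ r ∈ l, r y = w) :
    ∃ l' : List C(Y, ℝ), ∀ y t, a y ≤ t → (∃ r ∈ l, t ≤ r y) → G y t = 0 →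
      ∃ r ∈ l', r y = t := by
  induction l generalizing a with
  | nil => exact ⟨[], by simp⟩
  | cons b l ih =>
    rw [List.pairwise_cons] at hl
    have hab : a ≤ b := hl.1 b List.mem_cons_self
    obtain ⟨l', hl'⟩ := ih b hl.2 fun y w hw => by
      rcases hcrit y w hw with h | ⟨r, hr, rfl⟩
      · exact Or.inl (h.trans (hab y))
      · rcases List.mem_cons.1 hr with rfl | hr
        · exact Or.inl le_rfl
        · exact Or.inr ⟨r, hr, rfl⟩
    -- Every critical point is at most `a y` or is a value of the sorted tail, hence at least `b y`;
    -- none lies strictly between.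
    obtain ⟨r₀, hr₀⟩ := exists_continuous_zero hG hab fun y => hinj y _ _ fun w hw hwc => by
      rcases hcrit y w hwc with h | ⟨r, hr, rfl⟩
      · exact absurd hw.1 (not_lt.2 h)
      · rcases List.mem_cons.1 hr with rfl | hr
        · exact lt_irrefl _ hw.2
        · exact absurd hw.2 (not_lt.2 ((List.pairwise_cons.1 hl.2).1 r hr y))
    refine ⟨r₀ :: l', fun y t hat hr h0 => ?_⟩
    rcases le_total t (b y) with htb | hbt
    · exact ⟨r₀, List.mem_cons_self, hr₀ y t ⟨hat, htb⟩ h0⟩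
    · obtain ⟨r, hr, htr⟩ := hr
      rcases List.mem_cons.1 hr with rfl | hr
      · exact ⟨r₀, List.mem_cons_self, hr₀ y t ⟨hat, htr⟩ h0⟩
      · obtain ⟨s, hs, hst⟩ := hl' y t hbt ⟨r, hr, htr⟩ h0
        exact ⟨s, List.mem_cons_of_mem _ hs, hst⟩

theorem injOn_of_derivative_ne_zero (q : ℝ[X]) {u v : ℝ}
    (h : ∀ w ∈ Ioo u v, ¬ q.derivative.IsRoot w) : InjOn (fun t => q.eval t) (Icc u v) := by
  have key : ∀ s ∈ Icc u v, ∀ t ∈ Icc u v, s < t → q.eval s ≠ q.eval t := by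
    intro s hs t ht hst heq
    obtain ⟨w, hw, hw0⟩ := exists_hasDerivAt_eq_zero (f := fun t => q.eval t)
      (f' := fun t => q.derivative.eval t) hst q.continuous.continuousOn heq
      fun x _ => q.hasDerivAt x
    exact h w ⟨hs.1.trans_lt hw.1, hw.2.trans_le ht.2⟩ hw0
  intro s hs t ht heq
  rcases lt_trichotomy s t with hst | hst | hst
  · exact absurd heq (key s hs t ht hst)
  · exact hst
  · exact absurd heq.symm (key t ht s hs hst)

/-- The real roots of a polynomial of fixed degree with continuous coefficients are covered by
finitely many continuous functions. -/
theorem exists_list_continuous_roots (n : ℕ) (q : Y → ℝ[X])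
    (hq : ∀ i, Continuous fun y => (q y).coeff i) (hdeg : ∀ y, (q y).natDegree = n)
    (h0 : ∀ y, q y ≠ 0) :
    ∃ l : List C(Y, ℝ), ∀ y t, (q y).IsRoot t → ∃ r ∈ l, r y = t := by
  induction n generalizing q with
  | zero =>
    refine ⟨[], fun y t ht => ?_⟩
    have h1 := eq_C_of_natDegree_eq_zero (hdeg y)
    rw [h1, IsRoot, eval_C] at ht
    rw [ht, C_0] at h1
    exact absurd h1 (h0 y)
  | succ n ih =>
    have hder : ∀ y, (q y).derivative.natDegree = n := fun y => by
      rw [natDegree_derivative, hdeg y, Nat.add_sub_cancel]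
    obtain ⟨cs, hcs⟩ := ih (fun y => (q y).derivative)
      (fun i => by simp only [coeff_derivative]; exact (hq (i + 1)).mul continuous_const) hder
      (fun y hy => by
        have := derivative_eq_zero.1 hy
        rw [hdeg y] at this
        omega)
    have hlead : ∀ y, ‖(q y).coeff (n + 1)‖₊ ≠ 0 := fun y => by
      rw [← hdeg y, nnnorm_ne_zero_iff]
      exact leadingCoeff_ne_zero.2 (h0 y)
    -- The degree being constant, the leading coefficient never vanishes and the Cauchy bound is
    -- continuous in `y`.
    have hR : Continuous fun y => ((q y).cauchyBound : ℝ) := by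
      have : (fun y => (q y).cauchyBound) = fun y =>
          (Finset.range (n + 1)).sup (fun i => ‖(q y).coeff i‖₊) / ‖(q y).coeff (n + 1)‖₊ + 1 := by
        ext y
        rw [cauchyBound, leadingCoeff, hdeg y]
      refine NNReal.continuous_coe.comp ?_
      rw [this]
      refine Continuous.add (Continuous.div₀ ?_ (hq _).nnnorm hlead) continuous_const
      exact Continuous.finset_sup_apply fun i _ => (hq i).nnnorm
    -- The critical points cut the line into intervals of injectivity (Rolle), and plus and minus
    -- the Cauchy bound enclose all roots.
    obtain ⟨l, hl, hlc⟩ := exists_sorted ((-⟨_, hR⟩ : C(Y, ℝ)) :: ⟨_, hR⟩ :: cs)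
    cases l with
    | nil =>
      refine ⟨[], fun y t _ => ?_⟩
      obtain ⟨r, hr, -⟩ := hlc _ List.mem_cons_self y
      simp at hr
    | cons a l =>
      have hG : Continuous fun z : Y × ℝ => (q z.1).eval z.2 := by
        have : (fun z : Y × ℝ => (q z.1).eval z.2) = fun z : Y × ℝ =>
            ∑ i ∈ Finset.range (n + 1 + 1), (q z.1).coeff i * z.2 ^ i := by
          ext z
          rw [eval_eq_sum_range, hdeg]
        rw [this]
        exact continuous_finsetSum _ fun i _ =>
          ((hq i).comp continuous_fst).mul (continuous_snd.pow i)
      obtain ⟨l', hl'⟩ := exists_list_zeros (G := fun y t => (q y).eval t) hG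
        (crit := fun y => {w | (q y).derivative.IsRoot w})
        (fun y u v h => injOn_of_derivative_ne_zero (q y) h) l a hl fun y w hw => by
          obtain ⟨c, hc, hcw⟩ := hcs y w hw
          obtain ⟨r, hr, hrc⟩ :=
            hlc c (List.mem_cons_of_mem _ (List.mem_cons_of_mem _ hc)) y
          rcases List.mem_cons.1 hr with rfl | hr
          · exact Or.inl (hcw.symm.trans hrc.symm).le
          · exact Or.inr ⟨r, hr, hrc.trans hcw⟩
      refine ⟨l', fun y t ht => ?_⟩
      have hlt : |t| < (q y).cauchyBound := IsRoot.norm_lt_cauchyBound (h0 y) ht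
      rw [abs_lt] at hlt
      obtain ⟨r₁, hr₁, hr₁y⟩ := hlc _ List.mem_cons_self y
      obtain ⟨r₂, hr₂, hr₂y⟩ := hlc _ (List.mem_cons_of_mem _ List.mem_cons_self) y
      simp only [ContinuousMap.coe_neg, Pi.neg_apply, ContinuousMap.coe_mk] at hr₁y hr₂y
      have har₁ : a y ≤ r₁ y := by
        rcases List.mem_cons.1 hr₁ with rfl | h
        · exact le_rfl
        · exact (List.pairwise_cons.1 hl).1 r₁ h y
      have hat : a y ≤ t := by linarith
      refine hl' y t hat ⟨r₂, ?_, by linarith⟩ ht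
      rcases List.mem_cons.1 hr₂ with rfl | h
      · linarith
      · exact h

theorem exists_isRoot_of_monic_of_odd_natDegree {q : ℝ[X]} (hm : q.Monic)
    (hodd : Odd q.natDegree) : ∃ t, q.IsRoot t := by
  have hpos : 0 < q.natDegree := hodd.pos
  have h1 : Tendsto (fun x => q.eval x) atTop atTop :=
    q.tendsto_atTop_of_leadingCoeff_nonneg (natDegree_pos_iff_degree_pos.1 hpos)
      (by rw [hm.leadingCoeff]; exact zero_le_one)
  have hnd : (q.comp (-X)).natDegree = q.natDegree := by
    rw [natDegree_comp, natDegree_neg, natDegree_X, mul_one]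
  have h2 : Tendsto (fun x => (q.comp (-X)).eval x) atTop atBot :=
    (q.comp (-X)).tendsto_atBot_of_leadingCoeff_nonpos
      (natDegree_pos_iff_degree_pos.1 (hnd ▸ hpos))
      (by rw [leadingCoeff_comp (by simp), hm.leadingCoeff]; simp [hodd.neg_one_pow])
  obtain ⟨s, hs⟩ := (h1.eventually_ge_atTop 0).exists
  obtain ⟨t, ht⟩ := (h2.eventually_le_atBot 0).exists
  rw [eval_comp] at ht
  obtain ⟨x, hx⟩ := mem_range_of_exists_le_of_exists_ge q.continuous ⟨_, ht⟩ ⟨_, hs⟩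
  exact ⟨x, hx⟩

end ContinuousRoots

/-! ### Ordered quotient fields of `C(Y)`: order along the kernel filter, and real closedness -/

section RealQuotients

variable {Y : Type*} [TopologicalSpace Y] {K : Type*} [Field K] [Algebra ℝ K]

/-- The filter on `Y` generated by the zero-sets of the functions in the kernel of `ρ`. -/
def kerFilter (ρ : C(Y, ℝ) →ₐ[ℝ] K) : Filter Y where
  sets := {s | ∃ m : C(Y, ℝ), ρ m = 0 ∧ ∀ y, m y = 0 → y ∈ s}
  univ_sets := ⟨0, map_zero ρ, fun _ _ => mem_univ _⟩
  sets_of_superset := fun ⟨m, hm, h⟩ hst => ⟨m, hm, fun y hy => hst (h y hy)⟩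
  inter_sets := by
    rintro s t ⟨m, hm, hs⟩ ⟨k, hk, ht⟩
    refine ⟨m ^ 2 + k ^ 2, by simp [hm, hk], fun y hy => ?_⟩
    simp only [ContinuousMap.add_apply, ContinuousMap.pow_apply] at hy
    have h1 : m y ^ 2 = 0 := by nlinarith [sq_nonneg (m y), sq_nonneg (k y)]
    have h2 : k y ^ 2 = 0 := by nlinarith [sq_nonneg (m y), sq_nonneg (k y)]
    exact ⟨hs y (by simpa using h1), ht y (by simpa using h2)⟩

theorem eventually_kerFilter_iff {ρ : C(Y, ℝ) →ₐ[ℝ] K} {P : Y → Prop} :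
    (∀ᶠ y in kerFilter ρ, P y) ↔ ∃ m : C(Y, ℝ), ρ m = 0 ∧ ∀ y, m y = 0 → P y :=
  Iff.rfl

theorem exists_zero_of_map_eq_zero (ρ : C(Y, ℝ) →ₐ[ℝ] K) {m : C(Y, ℝ)} (hm : ρ m = 0) :
    ∃ y, m y = 0 := by
  by_contra! h
  have hu : m * ⟨fun y => (m y)⁻¹, m.continuous.inv₀ h⟩ = 1 := by
    ext y
    simp [h y]
  have := congrArg ρ hu
  rw [map_mul, hm, zero_mul, map_one] at this
  exact zero_ne_one this

instance kerFilter_neBot (ρ : C(Y, ℝ) →ₐ[ℝ] K) : (kerFilter ρ).NeBot := by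
  refine ⟨fun h => ?_⟩
  obtain ⟨m, hm, hm0⟩ := eventually_kerFilter_iff.1 (eventually_false_iff_eq_bot.2 h)
  obtain ⟨y, hy⟩ := exists_zero_of_map_eq_zero ρ hm
  exact hm0 y hy

/-- Membership in the kernel depends only on the zero-set, since a function in the kernel cannot be
zero-free. -/
theorem map_eq_iff_eventually {ρ : C(Y, ℝ) →ₐ[ℝ] K} (hρ : Function.Surjective ρ)
    {f g : C(Y, ℝ)} : ρ f = ρ g ↔ ∀ᶠ y in kerFilter ρ, f y = g y := by
  rw [eventually_kerFilter_iff]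
  constructor
  · intro h
    exact ⟨f - g, by rw [map_sub, h, sub_self], fun y hy => sub_eq_zero.1 hy⟩
  · rintro ⟨m, hm, hfg⟩
    by_contra hne
    have hne' : ρ (f - g) ≠ 0 := by rwa [map_sub, sub_ne_zero]
    obtain ⟨k, hk⟩ := hρ (ρ (f - g))⁻¹
    -- At a zero of this sum of squares both `m = 0`, so `f = g`, and `k (f - g) = 1`, which is
    -- absurd.
    obtain ⟨y, hy⟩ := exists_zero_of_map_eq_zero ρ (m := m ^ 2 + (1 - k * (f - g)) ^ 2) (by
      rw [map_add, map_pow, hm, map_pow, map_sub, map_one, map_mul, hk, inv_mul_cancel₀ hne']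
      simp)
    simp only [ContinuousMap.add_apply, ContinuousMap.pow_apply, ContinuousMap.sub_apply,
      ContinuousMap.mul_apply, ContinuousMap.one_apply] at hy
    have h1 : m y ^ 2 = 0 := by nlinarith [sq_nonneg (m y), sq_nonneg (1 - k y * (f y - g y))]
    rw [h1, hfg y (by simpa using h1)] at hy
    simp at hy

variable [LinearOrder K] [IsStrictOrderedRing K]

/-- Nonnegative functions are squares, so `ρ` is monotone for every field order on `K`; no
compatibility need be assumed. -/
theorem map_nonneg_of_nonneg (ρ : C(Y, ℝ) →ₐ[ℝ] K) {f : C(Y, ℝ)} (hf : ∀ y, 0 ≤ f y) :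
    0 ≤ ρ f := by
  have : f = (⟨fun y => √(f y), by fun_prop⟩ : C(Y, ℝ)) ^ 2 := by
    ext y
    simp [Real.sq_sqrt (hf y)]
  rw [this, map_pow]
  exact sq_nonneg _

theorem map_le_map_of_le (ρ : C(Y, ℝ) →ₐ[ℝ] K) {f g : C(Y, ℝ)} (h : f ≤ g) : ρ f ≤ ρ g := by
  rw [← sub_nonneg, ← map_sub]
  exact map_nonneg_of_nonneg ρ fun y => sub_nonneg.2 (h y)

theorem map_abs_eq_abs_map (ρ : C(Y, ℝ) →ₐ[ℝ] K) (f : C(Y, ℝ)) : ρ |f| = |ρ f| := by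
  have h0 : 0 ≤ ρ |f| := map_nonneg_of_nonneg ρ fun y => by simp
  have h : |f| ^ 2 = f ^ 2 := by
    ext y
    simp
  rw [← abs_of_nonneg h0, ← sq_eq_sq_iff_abs_eq_abs, ← map_pow, h, map_pow]

theorem map_le_iff_eventually {ρ : C(Y, ℝ) →ₐ[ℝ] K} (hρ : Function.Surjective ρ)
    {f g : C(Y, ℝ)} : ρ f ≤ ρ g ↔ ∀ᶠ y in kerFilter ρ, f y ≤ g y := by
  rw [← sub_nonneg, ← map_sub, ← abs_eq_self, ← map_abs_eq_abs_map, map_eq_iff_eventually hρ]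
  simp

theorem map_lt_iff_eventually {ρ : C(Y, ℝ) →ₐ[ℝ] K} (hρ : Function.Surjective ρ)
    {f g : C(Y, ℝ)} : ρ f < ρ g ↔ ∀ᶠ y in kerFilter ρ, f y < g y := by
  constructor
  · intro h
    -- A lift `k` of the inverse gives `k (g - f) = 1` along the filter, which excludes `f y = g y`.
    obtain ⟨k, hk⟩ := hρ (ρ (g - f))⁻¹
    have h1 : ρ (k * (g - f)) = ρ 1 := by
      rw [map_mul, hk, map_one, inv_mul_cancel₀]
      rw [map_sub]
      exact (sub_pos.2 h).ne'
    filter_upwards [(map_eq_iff_eventually hρ).1 h1, (map_le_iff_eventually hρ).1 h.le]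
      with y h2 h3
    refine lt_of_le_of_ne h3 fun h4 => ?_
    simp [h4] at h2
  · intro h
    rw [← not_le, map_le_iff_eventually hρ]
    intro h'
    obtain ⟨y, h1, h2⟩ := (h.and h').exists
    exact absurd h1 (not_lt.2 h2)

theorem map_sup_eq_max {ρ : C(Y, ℝ) →ₐ[ℝ] K} (hρ : Function.Surjective ρ) (f g : C(Y, ℝ)) :
    ρ (f ⊔ g) = max (ρ f) (ρ g) := by
  rcases le_total (ρ f) (ρ g) with h | h
  · rw [max_eq_right h, map_eq_iff_eventually hρ]
    filter_upwards [(map_le_iff_eventually hρ).1 h] with y hy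
    simp [hy]
  · rw [max_eq_left h, map_eq_iff_eventually hρ]
    filter_upwards [(map_le_iff_eventually hρ).1 h] with y hy
    simp [hy]

theorem map_inf_eq_min {ρ : C(Y, ℝ) →ₐ[ℝ] K} (hρ : Function.Surjective ρ) (f g : C(Y, ℝ)) :
    ρ (f ⊓ g) = min (ρ f) (ρ g) := by
  rcases le_total (ρ f) (ρ g) with h | h
  · rw [min_eq_left h, map_eq_iff_eventually hρ]
    filter_upwards [(map_le_iff_eventually hρ).1 h] with y hy
    simp [hy]
  · rw [min_eq_right h, map_eq_iff_eventually hρ]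
    filter_upwards [(map_le_iff_eventually hρ).1 h] with y hy
    simp [hy]

theorem isSquare_of_nonneg_of_surjective {ρ : C(Y, ℝ) →ₐ[ℝ] K} (hρ : Function.Surjective ρ)
    {x : K} (hx : 0 ≤ x) : IsSquare x := by
  obtain ⟨f, rfl⟩ := hρ x
  refine ⟨ρ ⟨fun y => √|f y|, by fun_prop⟩, ?_⟩
  rw [← abs_of_nonneg hx, ← map_abs_eq_abs_map, ← map_mul]
  congr 1
  ext y
  simp

open Polynomial in
theorem exists_isRoot_of_odd_of_surjective {ρ : C(Y, ℝ) →ₐ[ℝ] K} (hρ : Function.Surjective ρ)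
    {P : K[X]} (hP : Odd P.natDegree) : ∃ x, P.IsRoot x := by
  have hP0 : P ≠ 0 := by
    rintro rfl
    simp at hP
  wlog hm : P.Monic generalizing P
  · have hc : P.leadingCoeff⁻¹ ≠ 0 := inv_ne_zero (leadingCoeff_ne_zero.2 hP0)
    obtain ⟨x, hx⟩ := this (P := C P.leadingCoeff⁻¹ * P)
      (by rwa [natDegree_C_mul hc]) (mul_ne_zero (C_ne_zero.2 hc) hP0)
      (by rw [mul_comm]; exact monic_mul_leadingCoeff_inv hP0)
    refine ⟨x, ?_⟩
    rw [IsRoot, eval_mul, eval_C] at hx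
    exact (mul_eq_zero.1 hx).resolve_left hc
  -- A monic lift keeps the degree under evaluation at every point of `Y`, as the covering of the
  -- roots requires.
  obtain ⟨Q, hQP, hQd, hQm⟩ := lifts_and_natDegree_eq_and_monic (f := (ρ : C(Y, ℝ) →+* K))
    ((mem_lifts _).2 (map_surjective _ hρ P)) hm
  let ev : Y → C(Y, ℝ) →+* ℝ := fun y => (ContinuousMap.evalAlgHom ℝ ℝ y : C(Y, ℝ) →ₐ[ℝ] ℝ)
  have hevm : ∀ y, (Q.map (ev y)).Monic := fun y => hQm.map _
  have hevd : ∀ y, (Q.map (ev y)).natDegree = P.natDegree := fun y => by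
    rw [hQm.natDegree_map, hQd]
  obtain ⟨l, hl⟩ := exists_list_continuous_roots P.natDegree (fun y => Q.map (ev y))
    (fun i => by simp only [coeff_map]; exact (Q.coeff i).continuous) hevd
    fun y => (hevm y).ne_zero
  have hprod : (l.map fun r => Q.eval r).prod = 0 := by
    ext y
    obtain ⟨t, ht⟩ := exists_isRoot_of_monic_of_odd_natDegree (hevm y) (by rwa [hevd])
    obtain ⟨r, hr, hrt⟩ := hl y t ht
    change ev y _ = 0
    rw [map_list_prod]
    refine List.prod_eq_zero ?_
    rw [List.map_map, List.mem_map]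
    refine ⟨r, hr, ?_⟩
    have : t = ev y r := hrt.symm
    rw [IsRoot, this, eval_map_apply] at ht
    exact ht
  have h2 := congrArg ρ hprod
  rw [map_list_prod, map_zero, List.prod_eq_zero_iff, List.map_map, List.mem_map] at h2
  obtain ⟨r, -, hr⟩ := h2
  refine ⟨ρ r, ?_⟩
  rw [IsRoot, ← hQP]
  exact (eval_map_apply (f := (ρ : C(Y, ℝ) →+* K)) r).trans hr

theorem isRealClosed_of_surjective {ρ : C(Y, ℝ) →ₐ[ℝ] K} (hρ : Function.Surjective ρ) :
    IsRealClosed K :=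
  .of_linearOrderedField (isSquare_of_nonneg_of_surjective hρ)
    (exists_isRoot_of_odd_of_surjective hρ)

end RealQuotients

/-! ### Quotient fields of `C(Y)` other than `ℝ`: infinitely large elements and the `η₁` property -/

section HyperRealQuotients

/-- Either the residue field is `ℝ`, or it has an element exceeding every natural number. -/
theorem exists_forall_natCast_lt {K : Type*} [Field K] [Algebra ℝ K] [LinearOrder K]
    [IsStrictOrderedRing K] (hK : ¬ Nonempty (K ≃+* ℝ)) : ∃ x : K, ∀ n : ℕ, (n : K) < x := by
  by_contra! h
  have : Archimedean K := archimedean_iff_nat_le.2 h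
  refine hK ⟨RingEquiv.ofBijective
    (ConditionallyCompleteLinearOrderedField.inducedOrderRingHom K ℝ : K →+* ℝ)
    ⟨RingHom.injective _, fun r => ⟨algebraMap ℝ K r, ?_⟩⟩⟩
  -- The composite `ℝ → K → ℝ` is the identity, the only ring endomorphism of `ℝ`, so the embedding
  -- of `K` is onto.
  exact RingHom.congr_fun (Subsingleton.elim
    ((ConditionallyCompleteLinearOrderedField.inducedOrderRingHom K ℝ : K →+* ℝ).comp
      (algebraMap ℝ K)) (RingHom.id ℝ)) r

variable {Y : Type*} [TopologicalSpace Y]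

/-- The series `∑ aₙ · ramp (h - n)`, which is locally finite; `ramp` is the identity on `[0, 1]`
and constant on either side. -/
theorem exists_rampSum (h : C(Y, ℝ)) (a : ℕ → C(Y, ℝ)) :
    ∃ x : C(Y, ℝ), ∀ (y : Y) (N : ℕ), h y ≤ N →
      x y = ∑ n ∈ Finset.range N, a n y * max 0 (min 1 (h y - n)) := by
  have hz : ∀ (y : Y) (n : ℕ), h y ≤ n → a n y * max 0 (min 1 (h y - n)) = 0 := fun y n hn => by
    rw [max_eq_left ((min_le_right _ _).trans (sub_nonpos.2 hn)), mul_zero]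
  refine ⟨⟨fun y => ∑ᶠ n : ℕ, a n y * max 0 (min 1 (h y - n)), continuous_finsum
    (fun n => by fun_prop) fun y => ?_⟩, fun y N hN => ?_⟩
  · obtain ⟨N, hN⟩ := exists_nat_gt (h y)
    refine ⟨{z | h z < N}, (isOpen_lt h.continuous continuous_const).mem_nhds hN,
      (finite_lt_nat N).subset ?_⟩
    rintro n ⟨z, hz1, hz2⟩
    by_contra hn
    have hNn : (N : ℝ) ≤ n := by exact_mod_cast not_lt.1 hn
    have hzN : h z < N := hz2
    exact hz1 (hz z n (hzN.le.trans hNn))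
  · refine finsum_eq_sum_of_support_subset _ fun n hn => ?_
    rw [Finset.coe_range, mem_Iio]
    by_contra hNn
    have hNn' : (N : ℝ) ≤ n := by exact_mod_cast not_lt.1 hNn
    exact hn (hz y n (hN.trans hNn'))

variable {K : Type*} [Field K] [Algebra ℝ K] [LinearOrder K] [IsStrictOrderedRing K]
  {ρ : C(Y, ℝ) →ₐ[ℝ] K}

theorem tendsto_kerFilter_atTop (hρ : Function.Surjective ρ) {h : C(Y, ℝ)}
    (hh : ∀ n : ℕ, (n : K) < ρ h) : Tendsto h (kerFilter ρ) atTop := by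
  rw [tendsto_atTop]
  intro r
  obtain ⟨n, hn⟩ := exists_nat_ge r
  have h1 : ρ (n : C(Y, ℝ)) < ρ h := by
    rw [map_natCast]
    exact hh n
  filter_upwards [(map_lt_iff_eventually hρ).1 h1] with y hy
  exact hn.trans hy.le

theorem ramp_eq_one {t : ℝ} (ht : 1 ≤ t) : max 0 (min 1 t) = 1 := by
  rw [min_eq_left ht, max_eq_right zero_le_one]

/-- In the ramp series of the `|f n|`, the `n`-th term has full weight once `h ≥ n + 1`, and the
others are nonnegative; adding `1` makes the bound strict. -/
theorem exists_forall_lt_of_countable (hρ : Function.Surjective ρ) (hK : ¬ Nonempty (K ≃+* ℝ))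
    {S : Set K} (hS : S.Countable) : ∃ u, ∀ s ∈ S, s < u := by
  rcases S.eq_empty_or_nonempty with rfl | hne
  · exact ⟨0, by simp⟩
  obtain ⟨s, rfl⟩ := hS.exists_eq_range hne
  obtain ⟨e, he⟩ := exists_forall_natCast_lt hK
  obtain ⟨h, rfl⟩ := hρ e
  choose f hf using fun n => hρ (s n)
  obtain ⟨x, hx⟩ := exists_rampSum h fun n => |f n|
  refine ⟨ρ x + 1, forall_mem_range.2 fun n => lt_of_le_of_lt ?_ (lt_add_one _)⟩
  rw [← hf n, map_le_iff_eventually hρ]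
  filter_upwards [(tendsto_kerFilter_atTop hρ he).eventually_ge_atTop ((n : ℝ) + 1)] with y hy
  obtain ⟨N, hN⟩ := exists_nat_ge (h y)
  have hnN : n < N := by
    have : (n : ℝ) + 1 ≤ N := hy.trans hN
    exact_mod_cast this
  rw [hx y N hN]
  refine le_trans ?_ (Finset.single_le_sum (f := fun n : ℕ => |f n| y * max 0 (min 1 (h y - n)))
    (fun i _ => mul_nonneg (by simp) (le_max_left _ _)) (Finset.mem_range.2 hnN))
  simp only [ramp_eq_one (le_sub_iff_add_le'.2 hy), mul_one]
  exact le_abs_self (f n y)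

/-- Each new pair of lifts is clamped between the previous pair. Since every `a i` is at most every
`b j`, the clamping loses nothing in `K`. The nesting holds at every point of `Y`, which matters
because the number of terms of the series used later varies with the point. -/
theorem exists_nested_lifts (hρ : Function.Surjective ρ) {a b : ℕ → K}
    (hab : ∀ i j, a i ≤ b j) : ∃ f g : ℕ → C(Y, ℝ), Monotone f ∧ Antitone g ∧ (∀ n, f n ≤ g n) ∧
      (∀ n, a n ≤ ρ (f n)) ∧ ∀ n, ρ (g n) ≤ b n := by
  choose A hA using fun n => hρ (a n)
  choose B hB using fun n => hρ (b n)
  let P : ℕ → C(Y, ℝ) × C(Y, ℝ) := fun n => Nat.rec (A 0, A 0 ⊔ B 0)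
    (fun n p => (p.1 ⊔ (A (n + 1) ⊓ p.2),
      (p.1 ⊔ (A (n + 1) ⊓ p.2)) ⊔ (B (n + 1) ⊓ p.2))) n
  have h1 : ∀ n, (P (n + 1)).1 = (P n).1 ⊔ (A (n + 1) ⊓ (P n).2) := fun _ => rfl
  have h2 : ∀ n, (P (n + 1)).2 = (P (n + 1)).1 ⊔ (B (n + 1) ⊓ (P n).2) := fun _ => rfl
  have hle : ∀ n, (P n).1 ≤ (P n).2 := fun n => by
    cases n with
    | zero => exact le_sup_left
    | succ n => rw [h2]; exact le_sup_left
  have key : ∀ n, (a n ≤ ρ (P n).1 ∧ ρ (P n).2 ≤ b n) ∧ ∀ j, ρ (P n).1 ≤ b j ∧ a j ≤ ρ (P n).2 := by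
    intro n
    induction n with
    | zero =>
      have h0 : ρ (A 0 ⊔ B 0) = b 0 := by
        rw [map_sup_eq_max hρ, hA, hB, max_eq_right (hab 0 0)]
      exact ⟨⟨(hA 0).ge, h0.le⟩, fun j => ⟨(hA 0).le.trans (hab 0 j), (hab j 0).trans h0.ge⟩⟩
    | succ n ih =>
      have hf : ρ (P (n + 1)).1 = max (ρ (P n).1) (a (n + 1)) := by
        rw [h1, map_sup_eq_max hρ, map_inf_eq_min hρ, hA, min_eq_left (ih.2 _).2]
      have hg : ρ (P (n + 1)).2 = min (b (n + 1)) (ρ (P n).2) := by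
        rw [h2, map_sup_eq_max hρ, map_inf_eq_min hρ, hB, hf, max_eq_right]
        exact max_le (le_min (ih.2 _).1 (map_le_map_of_le ρ (hle n)))
          (le_min (hab _ _) (ih.2 _).2)
      rw [hf, hg]
      exact ⟨⟨le_max_right _ _, min_le_left _ _⟩, fun j =>
        ⟨max_le (ih.2 j).1 (hab _ _), le_min (hab _ _) (ih.2 j).2⟩⟩
  refine ⟨fun n => (P n).1, fun n => (P n).2, monotone_nat_of_le_succ fun n => ?_,
    antitone_nat_of_succ_le fun n => ?_, hle, fun n => (key n).1.1, fun n => (key n).1.2⟩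
  · rw [h1]
    exact le_sup_left
  · rw [h2, h1]
    exact sup_le (sup_le (hle n) inf_le_right) inf_le_right

/-- The interpolant is `f 0` plus the ramp series of the increments of `f`. Where `h ≥ n`, the first
`n` increments count in full, so it is at least `f n`; everywhere it is at most some `f N`, hence at
most every `g n`. -/
theorem exists_between_seq (hρ : Function.Surjective ρ) (hK : ¬ Nonempty (K ≃+* ℝ))
    {a b : ℕ → K} (hab : ∀ i j, a i ≤ b j) : ∃ x, ∀ n, a n ≤ x ∧ x ≤ b n := by
  obtain ⟨f, g, hf, hg, hfg, hfa, hgb⟩ := exists_nested_lifts hρ hab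
  obtain ⟨e, he⟩ := exists_forall_natCast_lt hK
  obtain ⟨h, rfl⟩ := hρ e
  obtain ⟨x, hx⟩ := exists_rampSum h fun n => f (n + 1) - f n
  have hinc : ∀ n y, 0 ≤ (f (n + 1) - f n) y := fun n y => sub_nonneg.2 (hf n.le_succ y)
  have htel : ∀ n y, f 0 y + ∑ i ∈ Finset.range n, (f (i + 1) - f i) y = f n y := fun n y => by
    simp only [ContinuousMap.sub_apply]
    rw [Finset.sum_range_sub fun i => f i y]
    ring
  refine ⟨ρ (f 0 + x), fun n => ⟨(hfa n).trans ((map_le_iff_eventually hρ).2 ?_),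
    (map_le_map_of_le ρ fun y => ?_).trans (hgb n)⟩⟩
  · filter_upwards [(tendsto_kerFilter_atTop hρ he).eventually_ge_atTop (n : ℝ)] with y hy
    obtain ⟨N, hN⟩ := exists_nat_ge (h y)
    have hnN : n ≤ N := by exact_mod_cast hy.trans hN
    rw [ContinuousMap.add_apply, hx y N hN, ← htel n y, add_le_add_iff_left]
    refine le_trans (le_of_eq ?_) (Finset.sum_le_sum_of_subset_of_nonneg
      (Finset.range_subset_range.2 hnN) fun i _ _ => mul_nonneg (hinc i y) (le_max_left _ _))
    refine Finset.sum_congr rfl fun i hi => ?_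
    have : (i : ℝ) + 1 ≤ n := by exact_mod_cast Finset.mem_range.1 hi
    rw [ramp_eq_one (by linarith), mul_one]
  · obtain ⟨N, hN⟩ := exists_nat_ge (h y)
    have hfN : f N y ≤ g n y := (hf (le_max_left N n) y).trans
      ((hfg (max N n) y).trans (hg (le_max_right N n) y))
    change f 0 y + x y ≤ g n y
    rw [hx y N hN]
    refine le_trans ?_ hfN
    rw [← htel N y, add_le_add_iff_left]
    exact Finset.sum_le_sum fun i _ => mul_le_of_le_one_right (hinc i y)
      (max_le zero_le_one (min_le_left _ _))

theorem isEtaOne_of_surjective (hρ : Function.Surjective ρ) (hK : ¬ Nonempty (K ≃+* ℝ)) :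
    IsEtaOne K := by
  intro S T hS hT hST
  rcases S.eq_empty_or_nonempty with rfl | hSn
  · obtain ⟨u, hu⟩ := exists_forall_lt_of_countable hρ hK (hT.image Neg.neg)
    exact ⟨-u, by simp, fun t ht => neg_lt.1 (hu _ (mem_image_of_mem _ ht))⟩
  rcases T.eq_empty_or_nonempty with rfl | hTn
  · obtain ⟨u, hu⟩ := exists_forall_lt_of_countable hρ hK hS
    exact ⟨u, hu, by simp⟩
  obtain ⟨s, rfl⟩ := hS.exists_eq_range hSn
  obtain ⟨t, rfl⟩ := hT.exists_eq_range hTn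
  have hst : ∀ i j, 0 < t j - s i := fun i j =>
    sub_pos.2 (hST _ (mem_range_self i) _ (mem_range_self j))
  -- An upper bound `u` for the inverses of all gaps makes every gap exceed `u⁻¹`; moving both
  -- sequences inward by `u⁻¹ / 3` turns weak separation into strict.
  obtain ⟨u, hu⟩ := exists_forall_lt_of_countable hρ hK
    (countable_range fun ij : ℕ × ℕ => (t ij.2 - s ij.1)⁻¹)
  have hu' : ∀ i j, (t j - s i)⁻¹ < u := fun i j => hu _ (mem_range_self (i, j))
  have hupos : 0 < u := (inv_pos.2 (hst 0 0)).trans (hu' 0 0)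
  have hupos' : 0 < u⁻¹ := inv_pos.2 hupos
  have hgap : ∀ i j, u⁻¹ < t j - s i := fun i j => (inv_lt_comm₀ (hst i j) hupos).1 (hu' i j)
  obtain ⟨x, hx⟩ := exists_between_seq hρ hK (a := fun i => s i + u⁻¹ / 3)
    (b := fun j => t j - u⁻¹ / 3) fun i j => by linarith [hgap i j]
  refine ⟨x, forall_mem_range.2 fun n => ?_, forall_mem_range.2 fun n => ?_⟩
  · linarith [(hx n).1]
  · linarith [(hx n).2]

/-! ### Transcendence degree -/

/-- After division by the power with the largest exponent, all other terms tend to zero, so the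
leading coefficient vanishes; then induct. -/
theorem coeff_eq_zero_of_eventually_sum_rpow_eq_zero {α ι : Type*} {F : Filter α} [F.NeBot]
    {h : α → ℝ} (hh : Tendsto h F atTop) {φ : ι → ℝ} (hφ : Function.Injective φ) (c : ι → ℝ)
    (s : Finset ι) (h0 : ∀ᶠ y in F, ∑ i ∈ s, c i * h y ^ φ i = 0) : ∀ i ∈ s, c i = 0 := by
  classical
  induction s using Finset.induction_on_max_value φ with
  | empty => simp
  | insert a s has hmax ih =>
    have hlim : Tendsto (fun y => c a + ∑ i ∈ s, c i * h y ^ (-(φ a - φ i))) F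
        (𝓝 (c a + ∑ i ∈ s, c i * 0)) := by
      refine tendsto_const_nhds.add (tendsto_finsetSum _ fun i hi => ?_)
      have hlt : φ i < φ a := lt_of_le_of_ne (hmax i hi) fun he => has (hφ he ▸ hi)
      exact ((tendsto_rpow_neg_atTop (sub_pos.2 hlt)).comp hh).const_mul _
    have hzero : ∀ᶠ y in F, c a + ∑ i ∈ s, c i * h y ^ (-(φ a - φ i)) = 0 := by
      filter_upwards [h0, hh.eventually_gt_atTop 0] with y hy hpos
      rw [Finset.sum_insert has] at hy
      have hpa : 0 < h y ^ φ a := Real.rpow_pos_of_pos hpos _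
      refine (mul_eq_zero.1 (?_ : _ * h y ^ φ a = 0)).resolve_right hpa.ne'
      rw [← hy, add_mul, Finset.sum_mul]
      congr 1
      refine Finset.sum_congr rfl fun i _ => ?_
      rw [mul_assoc, ← Real.rpow_add hpos]
      congr 2
      ring
    have hca : c a = 0 := by
      have := tendsto_nhds_unique (tendsto_const_nhds.congr' (hzero.mono fun y hy => hy.symm)) hlim
      simpa using this.symm
    intro i hi
    rcases Finset.mem_insert.1 hi with rfl | hi
    · exact hca
    · refine ih (h0.mono fun y hy => ?_) i hi
      rwa [Finset.sum_insert has, hca, zero_mul, zero_add] at hy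

theorem exists_algebraicIndependent_rpow (hρ : Function.Surjective ρ)
    (hK : ¬ Nonempty (K ≃+* ℝ)) {ι : Type*} {v : ι → ℝ} (hv : LinearIndependent ℚ v) :
    ∃ x : ι → K, AlgebraicIndependent ℝ x := by
  obtain ⟨e, he⟩ := exists_forall_natCast_lt hK
  obtain ⟨h, rfl⟩ := hρ e
  -- Replacing `h` by `max h 1` makes all real powers continuous and leaves the behaviour at
  -- infinity unchanged.
  have hpos : ∀ y, 0 < max (h y) 1 := fun y => lt_max_of_lt_right one_pos
  let w : ι → C(Y, ℝ) := fun i => ⟨fun y => max (h y) 1 ^ v i,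
    Continuous.rpow_const (by fun_prop) fun y => Or.inl (hpos y).ne'⟩
  refine ⟨fun i => ρ (w i), algebraicIndependent_iff.2 fun p hp => ?_⟩
  -- Independence over `ℕ` says that distinct monomials `d` give distinct exponents `∑ d i * v i`.
  have hv' : LinearIndependent ℕ v := hv.restrict_scalars fun m n hmn => by simpa using hmn
  have heq : MvPolynomial.aeval (fun i => ρ (w i)) p = ρ (MvPolynomial.aeval w p) :=
    (MvPolynomial.comp_aeval_apply w ρ p).symm
  rw [heq, ← map_zero ρ, map_eq_iff_eventually hρ] at hp
  have hev : ∀ y, MvPolynomial.aeval w p y = ∑ d ∈ p.support,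
      p.coeff d * max (h y) 1 ^ (Finsupp.linearCombination ℕ v d) := fun y => by
    have h1 : MvPolynomial.aeval w p y = MvPolynomial.aeval (fun i => w i y) p :=
      MvPolynomial.comp_aeval_apply w (ContinuousMap.evalAlgHom ℝ ℝ y) p
    rw [h1, MvPolynomial.aeval_eq_eval, MvPolynomial.eval_eq]
    refine Finset.sum_congr rfl fun d _ => ?_
    rw [Finsupp.linearCombination_apply, Finsupp.sum, Real.rpow_sum_of_pos (hpos y)]
    congr 1
    refine Finset.prod_congr rfl fun i _ => ?_
    rw [nsmul_eq_mul, mul_comm, Real.rpow_mul_natCast (hpos y).le]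
    rfl
  have htop : Tendsto (fun y => max (h y) 1) (kerFilter ρ) atTop :=
    tendsto_atTop_mono (fun y => le_max_left _ _) (tendsto_kerFilter_atTop hρ he)
  have hc := coeff_eq_zero_of_eventually_sum_rpow_eq_zero htop hv' (fun d => p.coeff d) p.support
    (hp.mono fun y hy => by rw [← hev y, hy]; rfl)
  ext d
  rw [MvPolynomial.coeff_zero]
  by_contra hd
  exact hd (hc d (MvPolynomial.mem_support_iff.2 hd))

theorem continuum_le_trdeg_of_surjective (hρ : Function.Surjective ρ)
    (hK : ¬ Nonempty (K ≃+* ℝ)) :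
    Cardinal.continuum ≤ Algebra.trdeg ℝ K ∧ Cardinal.continuum ≤ Algebra.trdeg ℚ K := by
  let v := Module.Basis.ofVectorSpace ℚ ℝ
  have hcard : Cardinal.mk (Module.Basis.ofVectorSpaceIndex ℚ ℝ) = Cardinal.continuum := by
    have := v.mk_eq_rank
    rwa [Real.rank_rat_real, Cardinal.lift_id, Cardinal.lift_id] at this
  obtain ⟨x, hx⟩ := exists_algebraicIndependent_rpow hρ hK v.linearIndependent
  have hx' : AlgebraicIndependent ℚ x := hx.restrictScalars (algebraMap ℚ ℝ).injective
  have h1 := hx.lift_cardinalMk_le_trdeg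
  have h2 := hx'.lift_cardinalMk_le_trdeg
  rw [hcard, Cardinal.lift_continuum] at h1 h2
  simpa using And.intro h1 h2

end HyperRealQuotients

/-! ### The ring `A^ν` as an image of `C(υ_A X ∪ X)`, and the conclusion -/

namespace IntermediateRing

variable {X : Type u} [TopologicalSpace X]

/-- The subspace `υ_A X ∪ X` of `βX`, on which the functions of `A^ν` extend to real-valued
continuous functions. -/
def realSpace (A : IntermediateRing X) : Set (StoneCech X) :=
  A.realPoints ∪ range stoneCechUnit

/-- The canonical map of `X` into `υ_A X ∪ X`. -/
def toRealSpace (A : IntermediateRing X) : C(X, A.realSpace) where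
  toFun x := ⟨stoneCechUnit x, Or.inr (mem_range_self x)⟩
  continuous_toFun := continuous_stoneCechUnit.subtype_mk _

theorem comp_toRealSpace_mem_nu (A : IntermediateRing X) (g : C(A.realSpace, ℝ)) :
    g.comp A.toRealSpace ∈ A.nu.alg := by
  intro p hp
  have hq : p ∈ A.realSpace := mem_union_left _ hp
  refine ⟨g ⟨p, hq⟩, (stoneExt_eq_coe_iff _ _ _).2 ?_⟩
  have h : Tendsto A.toRealSpace (trace p) (𝓝 ⟨p, hq⟩) := by
    rw [nhds_subtype_eq_comap, tendsto_comap_iff]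
    exact tendsto_comap
  exact (g.continuous.tendsto _).comp h

/-- Restriction of continuous functions on `υ_A X ∪ X` to `X`, as a homomorphism into `A^ν`. -/
noncomputable def restrictToNu (A : IntermediateRing X) : C(A.realSpace, ℝ) →ₐ[ℝ] A.nu.alg :=
  (ContinuousMap.compRightAlgHom ℝ ℝ A.toRealSpace).codRestrict A.nu.alg
    A.comp_toRealSpace_mem_nu

/-- The preimage of `f` is its Stone extension, real on `υ_A X` by the definition of `A^ν` and on
`X` trivially; it is continuous into `ℝ` because `ℝ` is embedded in `OnePoint ℝ`. Adjoining `X`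
explicitly avoids having to show that it lies in `υ_A X`. -/
theorem restrictToNu_surjective (A : IntermediateRing X) :
    Function.Surjective A.restrictToNu := by
  rintro ⟨f, hf⟩
  have hunit : ∀ x, stoneExt f (stoneCechUnit x) = (f x : OnePoint ℝ) := fun x => by
    simp [stoneExt]
  have hreal : ∀ q : A.realSpace, ∃ r : ℝ, stoneExt f q = (r : OnePoint ℝ) := by
    rintro ⟨q, hq | ⟨x, rfl⟩⟩
    · exact hf q hq
    · exact ⟨f x, hunit x⟩
  choose g hg using hreal
  have hgc : Continuous g := by
    rw [OnePoint.isOpenEmbedding_coe.isEmbedding.continuous_iff]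
    have : ((↑) : ℝ → OnePoint ℝ) ∘ g = fun q : A.realSpace => stoneExt f q :=
      funext fun q => (hg q).symm
    rw [this]
    exact (continuous_stoneCechExtend _).comp continuous_subtype_val
  refine ⟨⟨g, hgc⟩, Subtype.ext (ContinuousMap.ext fun x => ?_)⟩
  have h := (hg (A.toRealSpace x)).symm.trans (hunit x)
  exact OnePoint.coe_injective h

/-- The residue map, as a homomorphism from the continuous functions on `υ_A X ∪ X`. -/
noncomputable def realSpaceResidue (A : IntermediateRing X) (p : StoneCech X) :
    C(A.realSpace, ℝ) →ₐ[ℝ] A.nu.ResidueField p where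
  toRingHom := (A.nu.residue p).comp A.restrictToNu
  commutes' r := congrArg (A.nu.residue p) (A.restrictToNu.commutes r)

theorem realSpaceResidue_surjective (A : IntermediateRing X) (p : StoneCech X) :
    Function.Surjective (A.realSpaceResidue p) :=
  (A.nu.residue_surjective p).comp A.restrictToNu_surjective

end IntermediateRing

theorem mainTheorem6 {X : Type u} [TopologicalSpace X] [T35Space X]
    (A : IntermediateRing X) (p : StoneCech X) (hp : p ∉ A.nu.realPoints) :
    IsRealClosed (A.nu.ResidueField p) ∧
      IsEtaOne (A.nu.ResidueField p) ∧
      Cardinal.continuum ≤ Algebra.trdeg ℝ (A.nu.ResidueField p) ∧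
      Cardinal.continuum ≤ Algebra.trdeg ℚ (A.nu.ResidueField p) :=
  have hρ := A.realSpaceResidue_surjective p
  ⟨isRealClosed_of_surjective hρ, isEtaOne_of_surjective hρ hp,
    continuum_le_trdeg_of_surjective hρ hp⟩
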